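/- All games are short two-player combinatorial games under normal play, $G+H$ is the disjunctive sum, and $G=H$ means equality of game values. The birthday $b(G)$ is the least height of the game tree of a form equal to $G$ (equivalently, the height of the game tree of the canonical form of $G$), and $*n=\{*0,\dots,*(n-1)\mid *0,\dots,*(n-1)\}$ for integers $n\ge 0$; a nimber is a game equal to some $*n$. A strong decomposition of a game $G$ is an equality $G=H+J$ with $H\neq 0$, $J\neq 0$ and $b(H)+b(J)=b(G)$; $G$ is strongly decomposable if it has a strong decomposition. \textbf{Theorem.} Let $k$ be a positive integer that is not a power of two (where $1=2^0$ counts as a power of two). Then $*k$ is strongly decomposable. Moreover, the only strong decompositions of $*k$ are sums of nimbers: if $*k=H+J$ is a strong decomposition, then both $H$ and $J$ are nimbers. -/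

import Mathlib

/-- Short game forms `{G^L | G^R}`: finitely many Left options `L i` and finitely many
Right options `R j`, each of them a short game form. -/
inductive ShortGame : Type
  | mk (m n : ℕ) (L : Fin m → ShortGame) (R : Fin n → ShortGame) : ShortGame

namespace ShortGame

/-- The number of Left options. -/
def numLeft : ShortGame → ℕ
  | mk m _ _ _ => m

/-- The number of Right options. -/
def numRight : ShortGame → ℕ
  | mk _ n _ _ => n

/-- The Left options of a form. -/
def left : (G : ShortGame) → Fin G.numLeft → ShortGame
  | mk _ _ L _ => L

/-- The Right options of a form. -/
def right : (G : ShortGame) → Fin G.numRight → ShortGame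
  | mk _ _ _ R => R

/-- The height of the game tree of a form (its formal birthday). -/
def height : ShortGame → ℕ
  | mk _ _ L R =>
    max (Finset.univ.sup fun i => height (L i) + 1) (Finset.univ.sup fun j => height (R j) + 1)

theorem height_left_lt (G : ShortGame) (i : Fin G.numLeft) : (G.left i).height < G.height := by
  cases G with
  | mk m n L R =>
    have h : height (L i) + 1 ≤ Finset.univ.sup fun i => height (L i) + 1 :=
      Finset.le_sup (f := fun i => height (L i) + 1) (Finset.mem_univ i)
    exact lt_of_lt_of_le (Nat.lt_of_succ_le h) (le_max_left _ _)

theorem height_right_lt (G : ShortGame) (j : Fin G.numRight) :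
    (G.right j).height < G.height := by
  cases G with
  | mk m n L R =>
    have h : height (R j) + 1 ≤ Finset.univ.sup fun j => height (R j) + 1 :=
      Finset.le_sup (f := fun j => height (R j) + 1) (Finset.mem_univ j)
    exact lt_of_lt_of_le (Nat.lt_of_succ_le h) (le_max_right _ _)

/-- The zero game `{ | }`. -/
instance : Zero ShortGame := ⟨mk 0 0 Fin.elim0 Fin.elim0⟩

/-- Conway's order of normal play: `G ≤ H` iff no Left option of `G` is `≥ H` and
no Right option of `H` is `≤ G`. -/
def le (G H : ShortGame) : Prop :=
  (∀ i : Fin G.numLeft, ¬ le H (G.left i)) ∧ (∀ j : Fin H.numRight, ¬ le (H.right j) G)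
termination_by G.height + H.height
decreasing_by
  · have := G.height_left_lt i
    omega
  · have := H.height_right_lt j
    omega

instance : LE ShortGame := ⟨le⟩

theorem le_iff (G H : ShortGame) :
    G ≤ H ↔ (∀ i, ¬ H ≤ G.left i) ∧ (∀ j, ¬ H.right j ≤ G) := by
  change le G H ↔ _
  rw [le]
  rfl

/-- Equality of games (equality of values): `G = H` iff `G ≤ H` and `H ≤ G`. -/
instance : HasEquiv ShortGame := ⟨fun G H => G ≤ H ∧ H ≤ G⟩

/-- Auxiliary to `add`: here `L i` is the map `H ↦ G^{L_i} + H` and `R j` is the map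
`H ↦ G^{R_j} + H`. -/
def addAux {m n : ℕ} (L : Fin m → ShortGame → ShortGame) (R : Fin n → ShortGame → ShortGame) :
    ShortGame → ShortGame
  | mk p q K S =>
    mk (m + p) (n + q)
      (Fin.append (fun i => L i (mk p q K S)) (fun i => addAux L R (K i)))
      (Fin.append (fun j => R j (mk p q K S)) (fun j => addAux L R (S j)))

/-- The disjunctive sum; see `add_mk` for its defining equation
`G + H = {G^L + H, G + H^L | G^R + H, G + H^R}`. -/
def add : ShortGame → ShortGame → ShortGame
  | mk _ _ L R => addAux (fun i => add (L i)) (fun j => add (R j))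

instance : Add ShortGame := ⟨add⟩

theorem add_mk {m n p q : ℕ} (L : Fin m → ShortGame) (R : Fin n → ShortGame)
    (K : Fin p → ShortGame) (S : Fin q → ShortGame) :
    mk m n L R + mk p q K S =
      mk (m + p) (n + q)
        (Fin.append (fun i => L i + mk p q K S) (fun i => mk m n L R + K i))
        (Fin.append (fun j => R j + mk p q K S) (fun j => mk m n L R + S j)) :=
  rfl

theorem le_refl_aux (G : ShortGame) :
    G ≤ G ∧ (∀ i, ¬ G ≤ G.left i) ∧ (∀ j, ¬ G.right j ≤ G) := by
  induction G with
  | mk m n L R ihL ihR =>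
    have hL : ∀ i, ¬ mk m n L R ≤ L i := fun i h => ((le_iff _ _).1 h).1 i (ihL i).1
    have hR : ∀ j, ¬ R j ≤ mk m n L R := fun j h => ((le_iff _ _).1 h).2 j (ihR j).1
    exact ⟨(le_iff _ _).2 ⟨hL, hR⟩, hL, hR⟩

theorem equiv_refl (G : ShortGame) : G ≈ G :=
  ⟨(le_refl_aux G).1, (le_refl_aux G).1⟩

/-- The birthday `b(G)` of a game: the least height of a form equal to `G`
(this is the height of the game tree of the canonical form of `G`). -/
noncomputable def birthday (G : ShortGame) : ℕ :=
  sInf {n | ∃ G' : ShortGame, G' ≈ G ∧ G'.height = n}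

/-- The minimum in the definition of the birthday is attained. -/
theorem exists_height_eq_birthday (G : ShortGame) :
    ∃ G' : ShortGame, G' ≈ G ∧ G'.height = G.birthday :=
  Nat.sInf_mem (s := {n | ∃ G' : ShortGame, G' ≈ G ∧ G'.height = n}) ⟨_, G, equiv_refl G, rfl⟩

/-- The canonical form `*n = {*0, …, *(n-1) | *0, …, *(n-1)}`. -/
def nim (n : ℕ) : ShortGame :=
  mk n n (fun i => nim i.val) (fun j => nim j.val)
termination_by n
decreasing_by
  · exact i.isLt
  · exact j.isLt

/-- A game is a nimber if it is equal to some `*n`. -/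
def IsNimber (G : ShortGame) : Prop :=
  ∃ n : ℕ, G ≈ nim n

/-- `G = H + J` is a strong decomposition of `G`. -/
def IsStrongDecomposition (G H J : ShortGame) : Prop :=
  ¬ H ≈ 0 ∧ ¬ J ≈ 0 ∧ H.birthday + J.birthday = G.birthday ∧ G ≈ H + J

/-- `G` is strongly decomposable. -/
def IsStronglyDecomposable (G : ShortGame) : Prop :=
  ∃ H J : ShortGame, IsStrongDecomposition G H J

end ShortGame

/-! Existence: write k = 2^n + r with 0 < r < 2^n. The binary digits of the summands are disjoint,
so nim addition (`nim_add_nim`) gives *k = *(2^n) + *r, and `birthday_nim` makes the birthdays add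
up.

Rigidity: a form of height less than n cannot tell *n from *(n+1) (`remote_nim`). Let H + J = *(k+1)
with heights adding up to at most k+1. Some Left option of H + J is at least *k; its height is at
most k, which forces it to equal *k (`equiv_nim_of_height_le`). That option leaves one of H, J
untouched, so by induction on k the untouched summand is a nimber, and the other is then a
difference of nimbers (`isNimber_of_height_add_le`). -/

namespace ShortGame

/-! ### Options and the order -/

/-- `X` is a Left option of `G`. -/
def IsLeftOption (X G : ShortGame) : Prop := ∃ i, G.left i = X

/-- `X` is a Right option of `G`. -/
def IsRightOption (X G : ShortGame) : Prop := ∃ j, G.right j = X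

theorem IsLeftOption.height_lt {X G : ShortGame} (h : IsLeftOption X G) :
    X.height < G.height := by
  obtain ⟨i, rfl⟩ := h
  exact G.height_left_lt i

theorem IsRightOption.height_lt {X G : ShortGame} (h : IsRightOption X G) :
    X.height < G.height := by
  obtain ⟨j, rfl⟩ := h
  exact G.height_right_lt j

theorem le_iff_options (G H : ShortGame) :
    G ≤ H ↔ (∀ X, IsLeftOption X G → ¬ H ≤ X) ∧ (∀ Y, IsRightOption Y H → ¬ Y ≤ G) := by
  rw [le_iff]
  simp [IsLeftOption, IsRightOption]

theorem le_self (G : ShortGame) : G ≤ G := (equiv_refl G).1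

theorem IsLeftOption.not_le {X G H : ShortGame} (h : IsLeftOption X G) (hGH : G ≤ H) :
    ¬ H ≤ X :=
  ((le_iff_options G H).1 hGH).1 X h

theorem IsRightOption.not_le {Y G H : ShortGame} (h : IsRightOption Y H) (hGH : G ≤ H) :
    ¬ Y ≤ G :=
  ((le_iff_options G H).1 hGH).2 Y h

theorem height_le_of_options {G : ShortGame} {n : ℕ}
    (hL : ∀ X, IsLeftOption X G → X.height < n) (hR : ∀ X, IsRightOption X G → X.height < n) :
    G.height ≤ n := by
  cases G with
  | mk p q L R =>
    exact max_le (Finset.sup_le fun i _ => hL (L i) ⟨i, rfl⟩)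
      (Finset.sup_le fun j _ => hR (R j) ⟨j, rfl⟩)

protected theorem le_trans {G H K : ShortGame} (hGH : G ≤ H) (hHK : H ≤ K) : G ≤ K := by
  induction hn : G.height + H.height + K.height using Nat.strong_induction_on
    generalizing G H K with
  | _ n ih =>
    refine (le_iff_options G K).2 ⟨fun X hX hKX => ?_, fun Y hY hYG => ?_⟩
    · have := hX.height_lt
      exact hX.not_le hGH (ih _ (by omega) hHK hKX rfl)
    · have := hY.height_lt
      exact hY.not_le hHK (ih _ (by omega) hYG hGH rfl)

/-! ### Disjunctive sums -/

theorem isLeftOption_add {X G H : ShortGame} :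
    IsLeftOption X (G + H) ↔
      (∃ Y, IsLeftOption Y G ∧ Y + H = X) ∨ (∃ Y, IsLeftOption Y H ∧ G + Y = X) := by
  cases G with
  | mk m n L R =>
  cases H with
  | mk p q K S =>
    rw [add_mk]
    constructor
    · rintro ⟨i, rfl⟩
      change Fin (m + p) at i
      induction i using Fin.addCases with
      | left i => exact Or.inl ⟨L i, ⟨i, rfl⟩, Eq.symm <| by exact Fin.append_left _ _ i⟩
      | right i => exact Or.inr ⟨K i, ⟨i, rfl⟩, Eq.symm <| by exact Fin.append_right _ _ i⟩
    · rintro (⟨_, ⟨i, rfl⟩, rfl⟩ | ⟨_, ⟨i, rfl⟩, rfl⟩)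
      · exact ⟨Fin.castAdd p i, Fin.append_left _ _ i⟩
      · exact ⟨Fin.natAdd m i, Fin.append_right _ _ i⟩

theorem isRightOption_add {X G H : ShortGame} :
    IsRightOption X (G + H) ↔
      (∃ Y, IsRightOption Y G ∧ Y + H = X) ∨ (∃ Y, IsRightOption Y H ∧ G + Y = X) := by
  cases G with
  | mk m n L R =>
  cases H with
  | mk p q K S =>
    rw [add_mk]
    constructor
    · rintro ⟨i, rfl⟩
      change Fin (n + q) at i
      induction i using Fin.addCases with
      | left i => exact Or.inl ⟨R i, ⟨i, rfl⟩, Eq.symm <| by exact Fin.append_left _ _ i⟩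
      | right i => exact Or.inr ⟨S i, ⟨i, rfl⟩, Eq.symm <| by exact Fin.append_right _ _ i⟩
    · rintro (⟨_, ⟨i, rfl⟩, rfl⟩ | ⟨_, ⟨i, rfl⟩, rfl⟩)
      · exact ⟨Fin.castAdd q i, Fin.append_left _ _ i⟩
      · exact ⟨Fin.natAdd n i, Fin.append_right _ _ i⟩

theorem IsLeftOption.add_right {X G : ShortGame} (h : IsLeftOption X G) (H : ShortGame) :
    IsLeftOption (X + H) (G + H) :=
  isLeftOption_add.2 (Or.inl ⟨X, h, rfl⟩)

theorem IsLeftOption.add_left {X G : ShortGame} (h : IsLeftOption X G) (H : ShortGame) :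
    IsLeftOption (H + X) (H + G) :=
  isLeftOption_add.2 (Or.inr ⟨X, h, rfl⟩)

theorem IsRightOption.add_right {X G : ShortGame} (h : IsRightOption X G) (H : ShortGame) :
    IsRightOption (X + H) (G + H) :=
  isRightOption_add.2 (Or.inl ⟨X, h, rfl⟩)

theorem IsRightOption.add_left {X G : ShortGame} (h : IsRightOption X G) (H : ShortGame) :
    IsRightOption (H + X) (H + G) :=
  isRightOption_add.2 (Or.inr ⟨X, h, rfl⟩)

theorem height_add_le (G H : ShortGame) : (G + H).height ≤ G.height + H.height := by
  induction hn : G.height + H.height using Nat.strong_induction_on generalizing G H with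
  | _ n ih =>
    refine height_le_of_options (fun X hX => ?_) (fun X hX => ?_)
    · rcases isLeftOption_add.1 hX with ⟨Y, hY, rfl⟩ | ⟨Y, hY, rfl⟩
      all_goals
        have := hY.height_lt
        exact (ih _ (by omega) _ _ rfl).trans_lt (by omega)
    · rcases isRightOption_add.1 hX with ⟨Y, hY, rfl⟩ | ⟨Y, hY, rfl⟩
      all_goals
        have := hY.height_lt
        exact (ih _ (by omega) _ _ rfl).trans_lt (by omega)

/-- Cancellation and monotonicity are proved together: each direction calls on the other for a move
in `G` or `H`. -/
theorem add_le_add_iff_right (G H K : ShortGame) : G + K ≤ H + K ↔ G ≤ H := by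
  induction hn : G.height + H.height + K.height using Nat.strong_induction_on
    generalizing G H K with
  | _ n ih =>
    constructor
    · intro h
      refine (le_iff_options G H).2 ⟨fun X hX hHX => ?_, fun Y hY hYG => ?_⟩
      · have := hX.height_lt
        exact (hX.add_right K).not_le h ((ih _ (by omega) H X K rfl).2 hHX)
      · have := hY.height_lt
        exact (hY.add_right K).not_le h ((ih _ (by omega) Y G K rfl).2 hYG)
    · intro h
      refine (le_iff_options _ _).2 ⟨fun X hX hle => ?_, fun Y hY hle => ?_⟩
      · rcases isLeftOption_add.1 hX with ⟨Z, hZ, rfl⟩ | ⟨Z, hZ, rfl⟩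
        all_goals have := hZ.height_lt
        · exact hZ.not_le h ((ih _ (by omega) H Z K rfl).1 hle)
        · exact (hZ.add_left H).not_le (le_self _)
            (ShortGame.le_trans hle ((ih _ (by omega) G H Z rfl).2 h))
      · rcases isRightOption_add.1 hY with ⟨Z, hZ, rfl⟩ | ⟨Z, hZ, rfl⟩
        all_goals have := hZ.height_lt
        · exact hZ.not_le h ((ih _ (by omega) Z G K rfl).1 hle)
        · exact (hZ.add_left G).not_le (le_self _)
            (ShortGame.le_trans ((ih _ (by omega) G H Z rfl).2 h) hle)

theorem add_comm_le (G H : ShortGame) : G + H ≤ H + G := by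
  induction hn : G.height + H.height using Nat.strong_induction_on generalizing G H with
  | _ n ih =>
    refine (le_iff_options _ _).2 ⟨fun X hX hle => ?_, fun Y hY hle => ?_⟩
    · rcases isLeftOption_add.1 hX with ⟨Z, hZ, rfl⟩ | ⟨Z, hZ, rfl⟩
      all_goals have := hZ.height_lt
      · exact (hZ.add_left H).not_le hle (ih _ (by omega) Z H rfl)
      · exact (hZ.add_right G).not_le hle (ih _ (by omega) G Z rfl)
    · rcases isRightOption_add.1 hY with ⟨Z, hZ, rfl⟩ | ⟨Z, hZ, rfl⟩
      all_goals have := hZ.height_lt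
      · exact (hZ.add_left G).not_le hle (ih _ (by omega) G Z rfl)
      · exact (hZ.add_right H).not_le hle (ih _ (by omega) Z H rfl)

theorem add_assoc_equiv (G H K : ShortGame) : G + H + K ≈ G + (H + K) := by
  induction hn : G.height + H.height + K.height using Nat.strong_induction_on
    generalizing G H K with
  | _ n ih =>
    constructor
    · refine (le_iff_options _ _).2 ⟨fun X hX hle => ?_, fun Y hY hle => ?_⟩
      · rcases isLeftOption_add.1 hX with ⟨Z, hZ, rfl⟩ | ⟨Z, hZ, rfl⟩
        · rcases isLeftOption_add.1 hZ with ⟨W, hW, rfl⟩ | ⟨W, hW, rfl⟩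
          all_goals have := hW.height_lt
          · exact (hW.add_right _).not_le hle (ih _ (by omega) W H K rfl).1
          · exact ((hW.add_right K).add_left G).not_le hle (ih _ (by omega) G W K rfl).1
        · have := hZ.height_lt
          exact ((hZ.add_left H).add_left G).not_le hle (ih _ (by omega) G H Z rfl).1
      · rcases isRightOption_add.1 hY with ⟨Z, hZ, rfl⟩ | ⟨Z, hZ, rfl⟩
        · have := hZ.height_lt
          exact ((hZ.add_right H).add_right K).not_le hle (ih _ (by omega) Z H K rfl).1
        · rcases isRightOption_add.1 hZ with ⟨W, hW, rfl⟩ | ⟨W, hW, rfl⟩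
          all_goals have := hW.height_lt
          · exact ((hW.add_left G).add_right K).not_le hle (ih _ (by omega) G W K rfl).1
          · exact (hW.add_left _).not_le hle (ih _ (by omega) G H W rfl).1
    · refine (le_iff_options _ _).2 ⟨fun X hX hle => ?_, fun Y hY hle => ?_⟩
      · rcases isLeftOption_add.1 hX with ⟨Z, hZ, rfl⟩ | ⟨Z, hZ, rfl⟩
        · have := hZ.height_lt
          exact ((hZ.add_right H).add_right K).not_le hle (ih _ (by omega) Z H K rfl).2
        · rcases isLeftOption_add.1 hZ with ⟨W, hW, rfl⟩ | ⟨W, hW, rfl⟩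
          all_goals have := hW.height_lt
          · exact ((hW.add_left G).add_right K).not_le hle (ih _ (by omega) G W K rfl).2
          · exact (hW.add_left _).not_le hle (ih _ (by omega) G H W rfl).2
      · rcases isRightOption_add.1 hY with ⟨Z, hZ, rfl⟩ | ⟨Z, hZ, rfl⟩
        · rcases isRightOption_add.1 hZ with ⟨W, hW, rfl⟩ | ⟨W, hW, rfl⟩
          all_goals have := hW.height_lt
          · exact (hW.add_right _).not_le hle (ih _ (by omega) W H K rfl).2
          · exact ((hW.add_right K).add_left G).not_le hle (ih _ (by omega) G W K rfl).2
        · have := hZ.height_lt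
          exact ((hZ.add_left H).add_left G).not_le hle (ih _ (by omega) G H Z rfl).2

protected theorem equiv_symm {G H : ShortGame} (h : G ≈ H) : H ≈ G := ⟨h.2, h.1⟩

protected theorem equiv_trans {G H K : ShortGame} (h : G ≈ H) (h' : H ≈ K) : G ≈ K :=
  ⟨ShortGame.le_trans h.1 h'.1, ShortGame.le_trans h'.2 h.2⟩

theorem add_comm_equiv (G H : ShortGame) : G + H ≈ H + G := ⟨add_comm_le G H, add_comm_le H G⟩

theorem add_right_equiv {G H : ShortGame} (h : G ≈ H) (K : ShortGame) : G + K ≈ H + K :=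
  ⟨(add_le_add_iff_right G H K).2 h.1, (add_le_add_iff_right H G K).2 h.2⟩

theorem add_left_equiv {G H : ShortGame} (h : G ≈ H) (K : ShortGame) : K + G ≈ K + H :=
  ShortGame.equiv_trans (add_comm_equiv K G)
    (ShortGame.equiv_trans (add_right_equiv h K) (add_comm_equiv H K))

/-! ### Nimbers -/

theorem isLeftOption_nim {X : ShortGame} {n : ℕ} :
    IsLeftOption X (nim n) ↔ ∃ i < n, nim i = X := by
  rw [nim]
  exact ⟨fun ⟨i, hi⟩ => ⟨i.1, i.2, hi⟩, fun ⟨i, hi, h⟩ => ⟨⟨i, hi⟩, h⟩⟩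

theorem isRightOption_nim {X : ShortGame} {n : ℕ} :
    IsRightOption X (nim n) ↔ ∃ i < n, nim i = X := by
  rw [nim]
  exact ⟨fun ⟨i, hi⟩ => ⟨i.1, i.2, hi⟩, fun ⟨i, hi, h⟩ => ⟨⟨i, hi⟩, h⟩⟩

theorem height_nim_le (n : ℕ) : (nim n).height ≤ n := by
  induction n using Nat.strong_induction_on with
  | _ n ih =>
    refine height_le_of_options (fun X hX => ?_) (fun X hX => ?_)
    · obtain ⟨i, hi, rfl⟩ := isLeftOption_nim.1 hX
      exact (ih i hi).trans_lt hi
    · obtain ⟨i, hi, rfl⟩ := isRightOption_nim.1 hX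
      exact (ih i hi).trans_lt hi

/-- The smaller of two distinct nimbers is both a Left and a Right option of the larger, hence they
are incomparable. -/
theorem nim_le_nim_iff {a b : ℕ} : nim a ≤ nim b ↔ a = b := by
  refine ⟨fun h => ?_, fun h => h ▸ le_self _⟩
  rcases lt_trichotomy a b with hab | hab | hab
  · exact absurd (le_self _) ((isRightOption_nim.2 ⟨a, hab, rfl⟩).not_le h)
  · exact hab
  · exact absurd (le_self _) ((isLeftOption_nim.2 ⟨b, hab, rfl⟩).not_le h)

/-- Minimal-excludant argument: `key` reaches every value below `a ^^^ b` in one move, while `hne1`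
and `hne2` say that no move keeps the value. -/
theorem nim_add_nim (a b : ℕ) : nim a + nim b ≈ nim (a ^^^ b) := by
  induction hn : a + b using Nat.strong_induction_on generalizing a b with
  | _ n ih =>
    have key : ∀ c < a ^^^ b, (∃ i < a, nim i + nim b ≈ nim c) ∨
        (∃ i < b, nim a + nim i ≈ nim c) := by
      intro c hc
      rcases Nat.lt_xor_cases hc with h | h
      · refine Or.inl ⟨c ^^^ b, h, ?_⟩
        simpa [Nat.xor_assoc] using ih _ (by omega) (c ^^^ b) b rfl
      · refine Or.inr ⟨c ^^^ a, h, ?_⟩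
        simpa [Nat.xor_comm c a, ← Nat.xor_assoc] using ih _ (by omega) a (c ^^^ a) rfl
    have hne1 : ∀ i < a, i ^^^ b ≠ a ^^^ b := fun i hi h => hi.ne (Nat.xor_left_injective h)
    have hne2 : ∀ i < b, a ^^^ i ≠ a ^^^ b := fun i hi h => hi.ne (Nat.xor_right_injective h)
    constructor
    · refine (le_iff_options _ _).2 ⟨fun X hX hle => ?_, fun Y hY hle => ?_⟩
      · rcases isLeftOption_add.1 hX with ⟨Z, hZ, rfl⟩ | ⟨Z, hZ, rfl⟩ <;>
          obtain ⟨i, hi, rfl⟩ := isLeftOption_nim.1 hZ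
        · exact hne1 i hi
            (nim_le_nim_iff.1 (ShortGame.le_trans hle (ih _ (by omega) i b rfl).1)).symm
        · exact hne2 i hi
            (nim_le_nim_iff.1 (ShortGame.le_trans hle (ih _ (by omega) a i rfl).1)).symm
      · obtain ⟨c, hc, rfl⟩ := isRightOption_nim.1 hY
        rcases key c hc with ⟨i, hi, h⟩ | ⟨i, hi, h⟩
        · exact ((isRightOption_nim.2 ⟨i, hi, rfl⟩).add_right _).not_le hle h.1
        · exact ((isRightOption_nim.2 ⟨i, hi, rfl⟩).add_left _).not_le hle h.1
    · refine (le_iff_options _ _).2 ⟨fun X hX hle => ?_, fun Y hY hle => ?_⟩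
      · obtain ⟨c, hc, rfl⟩ := isLeftOption_nim.1 hX
        rcases key c hc with ⟨i, hi, h⟩ | ⟨i, hi, h⟩
        · exact ((isLeftOption_nim.2 ⟨i, hi, rfl⟩).add_right _).not_le hle h.2
        · exact ((isLeftOption_nim.2 ⟨i, hi, rfl⟩).add_left _).not_le hle h.2
      · rcases isRightOption_add.1 hY with ⟨Z, hZ, rfl⟩ | ⟨Z, hZ, rfl⟩ <;>
          obtain ⟨i, hi, rfl⟩ := isRightOption_nim.1 hZ
        · exact hne1 i hi
            (nim_le_nim_iff.1 (ShortGame.le_trans (ih _ (by omega) i b rfl).2 hle))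
        · exact hne2 i hi
            (nim_le_nim_iff.1 (ShortGame.le_trans (ih _ (by omega) a i rfl).2 hle))

theorem equiv_nim_zero_of_height_eq_zero {G : ShortGame} (h : G.height = 0) : G ≈ nim 0 := by
  constructor <;> refine (le_iff_options _ _).2 ⟨fun X hX => ?_, fun X hX => ?_⟩
  · have := hX.height_lt
    omega
  · obtain ⟨i, hi, -⟩ := isRightOption_nim.1 hX
    omega
  · obtain ⟨i, hi, -⟩ := isLeftOption_nim.1 hX
    omega
  · have := hX.height_lt
    omega

/-! ### Nimbers against forms of small height -/

/-- If `G = *(n + 1)`, then some Left option of `G` is at least `*n`. -/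
theorem exists_left_option_ge_nim {G : ShortGame} {n : ℕ} (h : G ≈ nim (n + 1)) :
    ∃ X, IsLeftOption X G ∧ nim n ≤ X := by
  by_contra! hX
  have hle : G ≤ nim n := by
    refine (le_iff_options _ _).2 ⟨hX, fun Y hY hle => ?_⟩
    obtain ⟨i, hi, rfl⟩ := isRightOption_nim.1 hY
    have := nim_le_nim_iff.1 (ShortGame.le_trans hle h.1)
    omega
  have := nim_le_nim_iff.1 (ShortGame.le_trans h.2 hle)
  omega

/-- A form of height less than `n` is not equal to `*n`, and it compares with `*n` as it does
with `*(n + 1)`. -/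
theorem remote_nim {G : ShortGame} {n : ℕ} (h : G.height < n) :
    ¬ G ≈ nim n ∧ (G ≤ nim n ↔ G ≤ nim (n + 1)) ∧ (nim n ≤ G ↔ nim (n + 1) ≤ G) := by
  induction hm : G.height using Nat.strong_induction_on generalizing G n with
  | _ m ih =>
    -- If `G = *(k+1)`, a Left option `X ≥ *k` has height below `k`, so by induction `X ≥ *(k+1)`,
    -- which no Left option of `G` satisfies.
    have hne : ¬ G ≈ nim n := by
      intro hG
      obtain ⟨k, rfl⟩ : ∃ k, n = k + 1 := ⟨n - 1, by omega⟩
      obtain ⟨X, hX, hle⟩ := exists_left_option_ge_nim hG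
      have := hX.height_lt
      have hrem := ih X.height (by omega) (G := X) (n := k) (by omega) rfl
      exact hX.not_le hG.1 (hrem.2.2.1 hle)
    refine ⟨hne, ⟨fun hG => ?_, fun hG => ?_⟩, ⟨fun hG => ?_, fun hG => ?_⟩⟩
    · refine (le_iff_options _ _).2 ⟨fun X hX hle => ?_, fun Y hY hle => ?_⟩
      · have := hX.height_lt
        exact hX.not_le hG ((ih X.height (by omega) (G := X) (n := n) (by omega) rfl).2.2.2 hle)
      · obtain ⟨i, hi, rfl⟩ := isRightOption_nim.1 hY
        rcases Nat.lt_succ_iff_lt_or_eq.1 hi with hi | rfl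
        · exact (isRightOption_nim.2 ⟨i, hi, rfl⟩).not_le hG hle
        -- The only option of `*(n+1)` that `*n` lacks is `*n` itself; it matters only if `G = *n`.
        · exact hne ⟨hG, hle⟩
    · refine (le_iff_options _ _).2 ⟨fun X hX hle => ?_, fun Y hY hle => ?_⟩
      · have := hX.height_lt
        exact hX.not_le hG ((ih X.height (by omega) (G := X) (n := n) (by omega) rfl).2.2.1 hle)
      · obtain ⟨i, hi, rfl⟩ := isRightOption_nim.1 hY
        exact (isRightOption_nim.2 ⟨i, by omega, rfl⟩).not_le hG hle
    · refine (le_iff_options _ _).2 ⟨fun X hX hle => ?_, fun Y hY hle => ?_⟩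
      · obtain ⟨i, hi, rfl⟩ := isLeftOption_nim.1 hX
        rcases Nat.lt_succ_iff_lt_or_eq.1 hi with hi | rfl
        · exact (isLeftOption_nim.2 ⟨i, hi, rfl⟩).not_le hG hle
        · exact hne ⟨hle, hG⟩
      · have := hY.height_lt
        exact hY.not_le hG ((ih Y.height (by omega) (G := Y) (n := n) (by omega) rfl).2.1.2 hle)
    · refine (le_iff_options _ _).2 ⟨fun X hX hle => ?_, fun Y hY hle => ?_⟩
      · obtain ⟨i, hi, rfl⟩ := isLeftOption_nim.1 hX
        exact (isLeftOption_nim.2 ⟨i, by omega, rfl⟩).not_le hG hle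
      · have := hY.height_lt
        exact hY.not_le hG ((ih Y.height (by omega) (G := Y) (n := n) (by omega) rfl).2.1.1 hle)

theorem birthday_nim (n : ℕ) : (nim n).birthday = n := by
  refine le_antisymm ?_ ?_
  · have h : (nim n).birthday ≤ (nim n).height := Nat.sInf_le ⟨nim n, equiv_refl _, rfl⟩
    exact h.trans (height_nim_le n)
  · obtain ⟨G, hG, hb⟩ := exists_height_eq_birthday (nim n)
    by_contra! h
    exact (remote_nim (by omega)).1 hG

/-- A form of height at most `n` which is at least `*n` but not at least `*(n + 1)` equals `*n`. -/
theorem equiv_nim_of_height_le {X : ShortGame} {n : ℕ} (hX : X.height ≤ n) (hle : nim n ≤ X)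
    (hlt : ¬ nim (n + 1) ≤ X) : X ≈ nim n := by
  by_contra hne
  -- If `X ≠ *n`, then `*(n+1) ≤ X`: among the options `*i` only `i = n` could be `≥ X`, which would
  -- give equality, and Right options of `X` are too short to separate `*n` from `*(n+1)`.
  refine hlt ((le_iff_options _ _).2 ⟨fun Z hZ hXZ => ?_, fun Y hY hYn => ?_⟩)
  · obtain ⟨i, hi, rfl⟩ := isLeftOption_nim.1 hZ
    obtain rfl := nim_le_nim_iff.1 (ShortGame.le_trans hle hXZ)
    exact hne ⟨hXZ, hle⟩
  · have := hY.height_lt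
    exact hY.not_le hle ((remote_nim (by omega)).2.1.2 hYn)

theorem equiv_add_nim_zero (G : ShortGame) : G ≈ G + nim 0 := by
  induction hn : G.height using Nat.strong_induction_on generalizing G with
  | _ n ih =>
    constructor <;> refine (le_iff_options _ _).2 ⟨fun X hX hle => ?_, fun Y hY hle => ?_⟩
    · have := hX.height_lt
      exact (hX.add_right _).not_le hle (ih _ (by omega) X rfl).1
    · rcases isRightOption_add.1 hY with ⟨Z, hZ, rfl⟩ | ⟨Z, hZ, rfl⟩
      · have := hZ.height_lt
        exact hZ.not_le (le_self _) (ShortGame.le_trans (ih _ (by omega) Z rfl).1 hle)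
      · obtain ⟨i, hi, -⟩ := isRightOption_nim.1 hZ
        omega
    · rcases isLeftOption_add.1 hX with ⟨Z, hZ, rfl⟩ | ⟨Z, hZ, rfl⟩
      · have := hZ.height_lt
        exact hZ.not_le (le_self _) (ShortGame.le_trans hle (ih _ (by omega) Z rfl).2)
      · obtain ⟨i, hi, -⟩ := isLeftOption_nim.1 hZ
        omega
    · have := hY.height_lt
      exact (hY.add_right _).not_le hle (ih _ (by omega) Y rfl).2

/-! ### Strong decompositions of nimbers -/

/-- Nimbers are their own negatives, so adding `*b` cancels `J`. -/
theorem isNimber_of_add_equiv_nim {H J : ShortGame} {b k : ℕ} (hJ : J ≈ nim b)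
    (h : H + J ≈ nim k) : H.IsNimber := by
  refine ⟨k ^^^ b, ?_⟩
  have h1 : nim 0 ≈ J + nim b := by
    have := nim_add_nim b b
    rw [Nat.xor_self] at this
    exact ShortGame.equiv_symm (ShortGame.equiv_trans (add_right_equiv hJ _) this)
  exact ShortGame.equiv_trans (equiv_add_nim_zero H) <| ShortGame.equiv_trans (add_left_equiv h1 H) <|
    ShortGame.equiv_trans (ShortGame.equiv_symm (add_assoc_equiv H J (nim b))) <|
    ShortGame.equiv_trans (add_right_equiv h _) (nim_add_nim k b)

/-- If two forms whose heights add up to at most `k` have sum `*k`, then both are nimbers. -/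
theorem isNimber_of_height_add_le {H J : ShortGame} {k : ℕ} (hk : H.height + J.height ≤ k)
    (h : H + J ≈ nim k) : H.IsNimber ∧ J.IsNimber := by
  induction k generalizing H J with
  | zero =>
    exact ⟨⟨0, equiv_nim_zero_of_height_eq_zero (by omega)⟩,
      ⟨0, equiv_nim_zero_of_height_eq_zero (by omega)⟩⟩
  | succ k ih =>
    obtain ⟨X, hX, hle⟩ := exists_left_option_ge_nim h
    have hXh := hX.height_lt
    have hsum := height_add_le H J
    have hXn := equiv_nim_of_height_le (by omega) hle (hX.not_le h.1 ·)
    -- Induction applies to the option and is used only for the summand that was not moved in.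
    rcases isLeftOption_add.1 hX with ⟨Z, hZ, rfl⟩ | ⟨Z, hZ, rfl⟩
    · have := hZ.height_lt
      obtain ⟨b, hb⟩ := (ih (by omega) hXn).2
      exact ⟨isNimber_of_add_equiv_nim hb h, b, hb⟩
    · have := hZ.height_lt
      obtain ⟨b, hb⟩ := (ih (by omega) hXn).1
      exact ⟨⟨b, hb⟩,
        isNimber_of_add_equiv_nim hb (ShortGame.equiv_trans (add_comm_equiv J H) h)⟩

theorem IsStrongDecomposition.isNimber {H J : ShortGame} {k : ℕ}
    (h : IsStrongDecomposition (nim k) H J) : H.IsNimber ∧ J.IsNimber := by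
  obtain ⟨-, -, hb, he⟩ := h
  -- The height bound concerns forms, so both summands are replaced by equal forms of least height.
  obtain ⟨H', hH, hHb⟩ := exists_height_eq_birthday H
  obtain ⟨J', hJ, hJb⟩ := exists_height_eq_birthday J
  rw [birthday_nim] at hb
  obtain ⟨⟨a, ha⟩, ⟨b, hb⟩⟩ := isNimber_of_height_add_le (H := H') (J := J') (k := k) (by omega)
    (ShortGame.equiv_trans (add_right_equiv hH J') <|
      ShortGame.equiv_trans (add_left_equiv hJ H) (ShortGame.equiv_symm he))
  exact ⟨⟨a, ShortGame.equiv_trans (ShortGame.equiv_symm hH) ha⟩,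
    ⟨b, ShortGame.equiv_trans (ShortGame.equiv_symm hJ) hb⟩⟩

theorem zero_equiv_nim_zero : (0 : ShortGame) ≈ nim 0 :=
  equiv_nim_zero_of_height_eq_zero (Nat.le_zero.1 (height_le_of_options
    (fun _ ⟨i, _⟩ => Fin.elim0 i) (fun _ ⟨i, _⟩ => Fin.elim0 i)))

theorem not_nim_equiv_zero {n : ℕ} (hn : n ≠ 0) : ¬ nim n ≈ 0 := fun h =>
  hn (nim_le_nim_iff.1 (ShortGame.equiv_trans h zero_equiv_nim_zero).1)

theorem two_pow_xor_of_lt {n r : ℕ} (hr : r < 2 ^ n) : 2 ^ n ^^^ r = 2 ^ n + r := by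
  refine Nat.eq_of_testBit_eq fun i => ?_
  have h := Nat.testBit_two_pow_mul_add 1 hr i
  rw [mul_one] at h
  rw [h, Nat.testBit_xor, Nat.testBit_two_pow]
  split_ifs with hi
  · simp [hi.ne']
  · push Not at hi
    rw [Nat.testBit_lt_two_pow (hr.trans_le (Nat.pow_le_pow_right two_pos hi)), Bool.eq_iff_iff]
    simp [Nat.testBit_one_eq_true_iff_self_eq_zero]
    omega

theorem isStronglyDecomposable_nim {k : ℕ} (hk : 0 < k) (hpow : ¬ ∃ n : ℕ, k = 2 ^ n) :
    (nim k).IsStronglyDecomposable := by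
  obtain ⟨n, h1, h2⟩ : ∃ n, 2 ^ n ≤ k ∧ k < 2 ^ (n + 1) :=
    ⟨Nat.log 2 k, Nat.pow_log_le_self 2 hk.ne', Nat.lt_pow_succ_log_self (by norm_num) k⟩
  -- This is what makes the remainder `r` nonzero.
  have h3 : k ≠ 2 ^ n := fun h => hpow ⟨_, h⟩
  have h4 : 2 ^ n ≠ 0 := by positivity
  rw [pow_succ] at h2
  obtain ⟨r, rfl⟩ := Nat.exists_eq_add_of_le h1
  refine ⟨nim (2 ^ n), nim r, not_nim_equiv_zero h4, not_nim_equiv_zero (by omega), ?_, ?_⟩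
  · simp only [birthday_nim]
  · have hxor := two_pow_xor_of_lt (n := n) (r := r) (by omega)
    rw [← hxor]
    exact ShortGame.equiv_symm (nim_add_nim _ _)

end ShortGame

theorem mainTheorem3 (k : ℕ) (hk : 0 < k) (hpow : ¬ ∃ n : ℕ, k = 2 ^ n) :
    (ShortGame.nim k).IsStronglyDecomposable ∧
      ∀ H J : ShortGame, ShortGame.IsStrongDecomposition (ShortGame.nim k) H J →
        H.IsNimber ∧ J.IsNimber :=
  ⟨ShortGame.isStronglyDecomposable_nim hk hpow, fun _ _ h => h.isNimber⟩
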